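/- **Setting.** $X,Y$ are random variables with finite alphabets $\mathcal X,\mathcal Y$ and an arbitrary joint law, $f:\mathcal X\times\mathcal Y\to\{0,1\}$ is a function, and $\epsilon\ge 0$. Logarithms are to base $2$, and all random variables are discrete. *Tension.* For jointly distributed $A,B$ with finite alphabets, the Wyner-tension is $$T_{\mathrm{Wyn}}(A;B)=\inf\{r_1+r_2:\ r_1,r_2\ge 0,\ \exists\, Q \text{ jointly distributed with } A,B:\ I(B;Q|A)\le r_1,\ I(A;Q|B)\le r_2,\ I(A;B|Q)=0\}.$$ *Protocols.* In a private-coin two-party protocol $\Pi$, party 1 has input $X$ and party 2 has input $Y$. The protocol fixes who speaks first, and the parties alternate sending messages (finite bit strings). At its turn a party draws either a message or the decision that the interaction is over from a distribution depending on its own input and the transcript so far; at the end each party draws its output from a distribution depending on its own input and the transcript. Messages are self-terminating given the transcript so far and either one of the two inputs: for every transcript $h$ so far and every input $x$, the messages that have positive probability after $h$ when $X=x$ form a prefix-free set, and the end of the interaction is either certain or impossible given $h$ and $x$; likewise for every input $y$ of party 2. We write $\Pi(X;Y)\mapsto(A;B)$ if $\Pi$ terminates with probability one and the outputs of the two parties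 are $A$ and $B$, jointly distributed with $(X,Y)$. Let $\Pi^{12}_{XY}$ and $\Pi^{21}_{XY}$ be the expected numbers of bits sent from party 1 to party 2 and from party 2 to party 1, over the inputs and the randomness of the protocol. *Communication complexity.* Let $\mathcal Z_\epsilon$ be the set of conditional laws $p_{Z|XY}$ of a binary random variable $Z$ such that the total variation distance $\frac12\sum_{x,y,z}|p_{ZXY}(z,x,y)-p_{f(X,Y)XY}(z,x,y)|$ is at most $\epsilon$. The average-case $\epsilon$-error communication complexity of $f$ is $$CC_\epsilon(f)=\inf\{r_1+r_2:\ r_1,r_2\ge0,\ \exists\, p_{Z|XY}\in\mathcal Z_\epsilon,\ \exists\,\Pi:\ \Pi(X;Y)\mapsto(Z;Z),\ \Pi^{12}_{XY}\le r_1,\ \Pi^{21}_{XY}\le r_2\}.$$ **Corollary.** For all $\epsilon\ge 0$, $$CC_\epsilon(f)\ \ge\ \inf_{p_{Z|XY}\in\mathcal Z_\epsilon}\bigl(T_{\mathrm{Wyn}}(XZ;YZ)-T_{\mathrm{Wyn}}(X;Y)\bigr),$$ where $XZ$ and $YZ$ denote the pairs $(X,Z)$ and $(Y,Z)$. In particular,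 if $X$ and $Y$ are independent, then $T_{\mathrm{Wyn}}(X;Y)=0$ and $$CC_\epsilon(f)\ \ge\ \inf_{p_{Z|XY}\in\mathcal Z_\epsilon}T_{\mathrm{Wyn}}(XZ;YZ).$$ -/

import Mathlib

noncomputable section

/-! ### Discrete information theory (all logarithms are to base `2`) -/

/-- Conditional mutual information `I(A; B | C)`, in bits, of discrete random variables `A`, `B`,
`C` on the discrete probability space `(Ω, p)`:
`∑ P(a,b,c) log₂ (P(a,b,c) P(c) / (P(a,c) P(b,c)))`.
(The sum converges absolutely as soon as at least two of the three alphabets are finite.) -/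
def condMutualInfo {Ω α β γ : Type*} (p : PMF Ω) (A : Ω → α) (B : Ω → β) (C : Ω → γ) : ℝ :=
  ∑' t : α × β × γ,
    ((p.map fun ω => (A ω, B ω, C ω)) t).toReal *
      Real.logb 2
        (((p.map fun ω => (A ω, B ω, C ω)) t).toReal * ((p.map C) t.2.2).toReal /
          (((p.map fun ω => (A ω, C ω)) (t.1, t.2.2)).toReal *
            ((p.map fun ω => (B ω, C ω)) (t.2.1, t.2.2)).toReal))

/-- Total variation distance of two distributions on a finite set. -/
def tvDist {α : Type*} [Fintype α] (p q : PMF α) : ℝ :=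
  (1 / 2) * ∑ a, |(p a).toReal - (q a).toReal|

/-! ### Tension -/

/-- The tension region of a pair `(A, B)` with joint law `p`: the triples `(r₁, r₂, r₃)` such that
for some (discrete) `Q` jointly distributed with `(A, B)` one has
`I(B;Q|A) ≤ r₁`, `I(A;Q|B) ≤ r₂` and `I(A;B|Q) ≤ r₃`. Here `q` is the joint law of
`((A, B), Q)`; a discrete `Q` may be taken to have values in `ℕ`. -/
def tensionRegion {α β : Type*} (p : PMF (α × β)) : Set (ℝ × ℝ × ℝ) :=
  {r | ∃ q : PMF ((α × β) × ℕ), q.map Prod.fst = p ∧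
    condMutualInfo q (fun ω => ω.1.2) (fun ω => ω.2) (fun ω => ω.1.1) ≤ r.1 ∧
    condMutualInfo q (fun ω => ω.1.1) (fun ω => ω.2) (fun ω => ω.1.2) ≤ r.2.1 ∧
    condMutualInfo q (fun ω => ω.1.1) (fun ω => ω.1.2) (fun ω => ω.2) ≤ r.2.2}

/-- The section `r₃ = c` of the tension region, within the nonnegative quadrant. -/
def tensionSlice {α β : Type*} (c : ℝ) (p : PMF (α × β)) : Set (ℝ × ℝ) :=
  {r | 0 ≤ r.1 ∧ 0 ≤ r.2 ∧ (r.1, r.2, c) ∈ tensionRegion p}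

/-- The Wyner-tension `T_Wyn(A;B)` of a pair `(A, B)` with joint law `p`. -/
def wynerTension {α β : Type*} (p : PMF (α × β)) : EReal :=
  ⨅ r ∈ tensionSlice 0 p, ((r.1 + r.2 : ℝ) : EReal)

/-! ### Two-party protocols -/

/-- A message is a finite bit string. -/
abbrev Message := List Bool

/-- A transcript is the list of the messages sent so far, the most recent one first. -/
abbrev Transcript := List Message

/-- A set of possible actions (`some m`: send the message `m`; `none`: the interaction is over)
is self-terminating if an observer who knows that set can tell from the bits alone when the message
ends, and knows beforehand whether there is a message at all. -/
def SelfTerminating (S : Set (Option Message)) : Prop :=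
  (none ∈ S → ∀ o ∈ S, o = none) ∧
  ∀ m m' : Message, some m ∈ S → some m' ∈ S → m <+: m' → m = m'

/-- A (private-coin) two-party protocol with inputs in `X`, `Y` and outputs in `A`, `B`. The parties
speak in turn. The party whose turn it is draws its next action from a distribution depending
on its view (its input and the transcript so far): either a message, or `none`, which ends the
interaction. At the end each party draws its output from a distribution depending on its view. -/
structure Protocol (X Y A B : Type*) where
  /-- Whether party 1 sends the first message. -/
  firstIsOne : Bool
  /-- Next action of party 1. -/
  next₁ : X → Transcript → PMF (Option Message)
  /-- Next action of party 2. -/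
  next₂ : Y → Transcript → PMF (Option Message)
  /-- Output of party 1. -/
  out₁ : X → Transcript → PMF A
  /-- Output of party 2. -/
  out₂ : Y → Transcript → PMF B

namespace Protocol

variable {X Y A B : Type*}

/-- Whether it is party 1's turn after the transcript `h`. -/
def turnOfOne (P : Protocol X Y A B) : Transcript → Bool
  | [] => P.firstIsOne
  | _ :: h => !(turnOfOne P h)

/-- The distribution of the next action after the transcript `h`, on inputs `x`, `y`. -/
def next (P : Protocol X Y A B) (x : X) (y : Y) (h : Transcript) : PMF (Option Message) :=
  if P.turnOfOne h then P.next₁ x h else P.next₂ y h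

/-- The probability that, on inputs `x`, `y`, the transcript starts with the messages of `h`. -/
def reachProb (P : Protocol X Y A B) (x : X) (y : Y) : Transcript → ENNReal
  | [] => 1
  | m :: h => reachProb P x y h * P.next x y h (some m)

/-- The probability that, on inputs `x`, `y`, the complete transcript is `h`. -/
def transcriptProb (P : Protocol X Y A B) (x : X) (y : Y) (h : Transcript) : ENNReal :=
  P.reachProb x y h * P.next x y h none

/-- The number of bits in the transcript sent by party 1 to party 2. -/
def bits₁₂ (P : Protocol X Y A B) : Transcript → ℕ
  | [] => 0
  | m :: h => bits₁₂ P h + if P.turnOfOne h then m.length else 0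

/-- The number of bits in the transcript sent by party 2 to party 1. -/
def bits₂₁ (P : Protocol X Y A B) : Transcript → ℕ
  | [] => 0
  | m :: h => bits₂₁ P h + if P.turnOfOne h then 0 else m.length

/-- The messages are self-terminating for each of the two parties, that is, given the transcript
so far and either one of the two inputs (the inputs being drawn from `p`). A third person who sees
only the transcript need not be able to parse it. -/
def IsSelfTerminating (P : Protocol X Y A B) (p : PMF (X × Y)) : Prop :=
  ∀ h : Transcript,
    (∀ x, SelfTerminating
      {o | ∃ y, p (x, y) ≠ 0 ∧ P.reachProb x y h ≠ 0 ∧ P.next x y h o ≠ 0}) ∧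
    (∀ y, SelfTerminating
      {o | ∃ x, p (x, y) ≠ 0 ∧ P.reachProb x y h ≠ 0 ∧ P.next x y h o ≠ 0})

/-- Run on inputs with law `p`, the protocol produces outputs `(A; B)` such that the joint law of
`((X, Y), (A, B))` is `r`. As `r` has total mass one, this includes that the protocol terminates
with probability one. -/
def Produces (P : Protocol X Y A B) (p : PMF (X × Y)) (r : PMF ((X × Y) × (A × B))) : Prop :=
  ∀ x y a b, r ((x, y), (a, b)) =
    p (x, y) * ∑' h, P.transcriptProb x y h * (P.out₁ x h a * P.out₂ y h b)

/-- Expected number of bits from party 1 to party 2, on inputs with law `p`. -/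
def rate₁₂ (P : Protocol X Y A B) (p : PMF (X × Y)) : ENNReal :=
  ∑' xy : X × Y, p xy * ∑' h, P.transcriptProb xy.1 xy.2 h * (P.bits₁₂ h : ENNReal)

/-- Expected number of bits from party 2 to party 1, on inputs with law `p`. -/
def rate₂₁ (P : Protocol X Y A B) (p : PMF (X × Y)) : ENNReal :=
  ∑' xy : X × Y, p xy * ∑' h, P.transcriptProb xy.1 xy.2 h * (P.bits₂₁ h : ENNReal)

end Protocol

/-! ### Communication complexity -/

/-- The achievable communication rate region for computing `(A; B)` given `(X; Y)`, where `r` is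
the joint law of `((X, Y), (A, B))`. -/
def rateRegion {X Y A B : Type*} (r : PMF ((X × Y) × (A × B))) : Set (ℝ × ℝ) :=
  {ρ | 0 ≤ ρ.1 ∧ 0 ≤ ρ.2 ∧ ∃ P : Protocol X Y A B,
    P.IsSelfTerminating (r.map Prod.fst) ∧ P.Produces (r.map Prod.fst) r ∧
    P.rate₁₂ (r.map Prod.fst) ≤ ENNReal.ofReal ρ.1 ∧
    P.rate₂₁ (r.map Prod.fst) ≤ ENNReal.ofReal ρ.2}

/-- The joint laws of `((X, Y), Z)`, for the binary random variables `Z` given by some `p_{Z|XY}`,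
that are within total variation distance `ε` of the law of `((X, Y), f(X, Y))`. -/
def approxLaws {X Y : Type*} [Fintype X] [Fintype Y] (p : PMF (X × Y)) (f : X × Y → Bool)
    (ε : ℝ) : Set (PMF ((X × Y) × Bool)) :=
  {r | r.map Prod.fst = p ∧ tvDist r (p.map fun xy => (xy, f xy)) ≤ ε}

/-- The communication complexity region of `f` with error `ε`, on inputs with law `p`; both parties
have to output the same `Z`. -/
def rateRegionOf {X Y : Type*} [Fintype X] [Fintype Y] (p : PMF (X × Y)) (f : X × Y → Bool)
    (ε : ℝ) : Set (ℝ × ℝ) :=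
  ⋃ r ∈ approxLaws p f ε, rateRegion (r.map fun ω => (ω.1, (ω.2, ω.2)))

/-- The average-case communication complexity of `f` with error `ε`, on inputs with law `p`. -/
def commComplexity {X Y : Type*} [Fintype X] [Fintype Y] (p : PMF (X × Y)) (f : X × Y → Bool)
    (ε : ℝ) : EReal :=
  ⨅ ρ ∈ rateRegionOf p f ε, ((ρ.1 + ρ.2 : ℝ) : EReal)

/-- The joint law of the pair `(XZ; YZ)`, from the joint law of `((X, Y), Z)`. -/
def pairLaw {X Y Z : Type*} (r : PMF ((X × Y) × Z)) : PMF ((X × Z) × (Y × Z)) :=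
  r.map fun ω => ((ω.1.1, ω.2), (ω.1.2, ω.2))

end

noncomputable section

open ENNReal

/-! ### Sums over the law of a random variable -/

section Expectation

variable {Ω α β γ υ : Type*} (μ : PMF Ω)

/-! Let `Q` be admissible for the Wyner-tension of `(X, Y)` and let `P` be a protocol with common
output `Z`. Run `P` with coins independent of `Q` given the inputs, and take the pair `Q' = (Q,
transcript)` as the auxiliary variable for `(XZ, YZ)`.

Conditional independence survives. A transcript probability is a product of a function of `x` and a
function of `y` (`exists_transcriptProb_eq_mul`), the outputs are drawn separately, and `X`, `Y` are
independent given `Q`. So the joint law factors given `Q'` (`condMutualInfo_jointLaw_eq_zero`).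

The other two terms grow by at most the communication. Given `x`, party 1's moves have known
probabilities and party 2's messages are prefix-free. Kraft's inequality thus gives a subprobability
`g` on transcripts, independent of `y`, with `P(t | x, y) ≤ g t * 2 ^ bits₂₁ t`
(`exists_transcriptProb_le`). By `condMutualInfo_le_add`, `I(YZ; Q' | XZ) ≤ I(Y; Q | X) +` the
expected number of bits from party 2. The other side follows by exchanging the parties. Taking the
infimum over `Q` bounds the increase of the tension by the sum of the two rates.

Since `Q` and the transcript have infinite alphabets, entropies may be infinite and no chain rule is
used. All information inequalities are pointwise bounds on likelihood ratios, averaged with `log t ≤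
t - 1`. -/

theorem PMF.tsum_map_mul (g : Ω → υ) (φ : υ → ℝ≥0∞) :
    ∑' u, μ.map g u * φ u = ∑' ω, μ ω * φ (g ω) := by
  classical
  simp_rw [PMF.map_apply, ← ENNReal.tsum_mul_right]
  rw [ENNReal.tsum_comm]
  refine tsum_congr fun ω => ?_
  rw [tsum_eq_single (g ω) (fun u hu => by simp [hu])]
  simp

theorem PMF.summable_mul_iff (φ : Ω → ℝ) :
    Summable (fun ω => (μ ω).toReal * φ ω) ↔ ∑' ω, μ ω * ENNReal.ofReal |φ ω| ≠ ∞ := by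
  have h1 : ∀ ω, (μ ω).toReal * |φ ω| = (μ ω * ENNReal.ofReal |φ ω|).toReal := fun ω => by
    rw [ENNReal.toReal_mul, ENNReal.toReal_ofReal (abs_nonneg _)]
  rw [← summable_abs_iff]
  simp_rw [abs_mul, abs_of_nonneg ENNReal.toReal_nonneg, h1]
  refine ⟨fun h => ?_, ENNReal.summable_toReal⟩
  have h2 : ∀ ω, μ ω * ENNReal.ofReal |φ ω| ≠ ∞ := fun ω =>
    ENNReal.mul_ne_top (μ.apply_ne_top ω) ENNReal.ofReal_ne_top
  have h3 := h.tsum_ofReal_ne_top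
  simpa only [ENNReal.ofReal_toReal (h2 _)] using h3

theorem PMF.summable_map_mul_iff (g : Ω → υ) (φ : υ → ℝ) :
    Summable (fun u => (μ.map g u).toReal * φ u) ↔
      Summable (fun ω => (μ ω).toReal * φ (g ω)) := by
  rw [PMF.summable_mul_iff, PMF.summable_mul_iff,
    PMF.tsum_map_mul μ g (fun u => ENNReal.ofReal |φ u|)]

/-- No summability is assumed: the two series converge together, and otherwise both have the default
value `0`. -/
theorem PMF.tsum_map_mul_real (g : Ω → υ) (φ : υ → ℝ) :
    ∑' u, (μ.map g u).toReal * φ u = ∑' ω, (μ ω).toReal * φ (g ω) := by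
  classical
  by_cases h : Summable (fun ω => (μ ω).toReal * φ (g ω))
  · rw [← (h.hasSum.tsum_fiberwise g).tsum_eq]
    refine tsum_congr fun u => ?_
    have h1 : ∀ b : g ⁻¹' {u}, (μ b).toReal * φ (g b) = (μ b).toReal * φ u := fun b => by
      rw [show g b = u from b.2]
    simp_rw [h1]
    rw [tsum_mul_right, PMF.map_apply]
    congr 1
    rw [← ENNReal.tsum_toReal_eq (fun b => μ.apply_ne_top _),
      tsum_subtype (g ⁻¹' {u}) (fun b => μ b)]
    congr 1
    refine tsum_congr fun ω => ?_
    by_cases hu : u = g ω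
    · simp [hu]
    · simp [hu, Ne.symm hu]
  · rw [tsum_eq_zero_of_not_summable h,
      tsum_eq_zero_of_not_summable (mt (PMF.summable_map_mul_iff μ g φ).1 h)]

/-- The probability that `A` takes the value which it takes at `ω`. -/
def PMF.probAt (A : Ω → α) (ω : Ω) : ℝ≥0∞ := μ.map A (A ω)

variable {μ}

theorem PMF.probAt_mono {A : Ω → α} {B : Ω → β} {ω : Ω}
    (h : ∀ ω', A ω = A ω' → B ω = B ω') : μ.probAt A ω ≤ μ.probAt B ω := by
  classical
  unfold PMF.probAt
  rw [PMF.map_apply, PMF.map_apply]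
  refine ENNReal.tsum_le_tsum fun ω' => ?_
  by_cases h1 : A ω = A ω'
  · simp [h1, h ω' h1]
  · simp [h1]

theorem PMF.probAt_congr {A : Ω → α} {B : Ω → β} {ω : Ω}
    (h : ∀ ω', A ω = A ω' ↔ B ω = B ω') : μ.probAt A ω = μ.probAt B ω :=
  le_antisymm (PMF.probAt_mono fun ω' => (h ω').1) (PMF.probAt_mono fun ω' => (h ω').2)

theorem PMF.probAt_ne_zero {A : Ω → α} {ω : Ω} (h : μ ω ≠ 0) : μ.probAt A ω ≠ 0 := by
  rw [PMF.probAt, ← PMF.mem_support_iff, PMF.mem_support_map_iff]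
  exact ⟨ω, h, rfl⟩

theorem PMF.probAt_ne_top {A : Ω → α} {ω : Ω} : μ.probAt A ω ≠ ∞ := PMF.apply_ne_top _ _

theorem PMF.probAt_toReal_pos {A : Ω → α} {ω : Ω} (h : μ ω ≠ 0) : 0 < (μ.probAt A ω).toReal :=
  ENNReal.toReal_pos (PMF.probAt_ne_zero h) PMF.probAt_ne_top

theorem PMF.tsum_map_pair (A : Ω → α) (B : Ω → β) (b : β) :
    ∑' a, μ.map (fun ω => (A ω, B ω)) (a, b) = μ.map B b := by
  classical
  simp_rw [PMF.map_apply]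
  rw [ENNReal.tsum_comm]
  refine tsum_congr fun ω => ?_
  rw [tsum_eq_single (A ω) (fun u hu => by simp [hu])]
  simp

/-- An expected likelihood ratio is at most the total mass of the numerator. Equality can fail,
because `N` may charge values that `g` never takes. -/
theorem PMF.tsum_mul_div_probAt_le (g : Ω → υ) (N : υ → ℝ≥0∞) :
    ∑' ω, μ ω * (N (g ω) / μ.probAt g ω) ≤ ∑' u, N u := by
  unfold PMF.probAt
  rw [← PMF.tsum_map_mul μ g (fun u => N u / μ.map g u)]
  exact ENNReal.tsum_le_tsum fun u => ENNReal.mul_div_le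

theorem PMF.summable_mul_div_probAt (g : Ω → υ) {N : υ → ℝ≥0∞} (hN : ∑' u, N u ≠ ∞) :
    Summable fun ω => (μ ω).toReal * ((N (g ω)).toReal / (μ.probAt g ω).toReal) := by
  have h := ENNReal.summable_toReal
    (ne_top_of_le_ne_top hN (PMF.tsum_mul_div_probAt_le (μ := μ) g N))
  simpa [ENNReal.toReal_mul, ENNReal.toReal_div] using h

theorem PMF.tsum_mul_div_probAt_le_one (g : Ω → υ) {N : υ → ℝ≥0∞} (hN : ∑' u, N u ≤ 1) :
    ∑' ω, (μ ω).toReal * ((N (g ω)).toReal / (μ.probAt g ω).toReal) ≤ 1 := by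
  have h := (PMF.tsum_mul_div_probAt_le (μ := μ) g N).trans hN
  have h' := ENNReal.toReal_mono ENNReal.one_ne_top h
  rw [ENNReal.tsum_toReal_eq
    (fun ω => ENNReal.ne_top_of_tsum_ne_top (ne_top_of_le_ne_top ENNReal.one_ne_top h) ω)] at h'
  simpa [ENNReal.toReal_mul, ENNReal.toReal_div] using h'

theorem PMF.hasSum_toReal (μ : PMF Ω) : HasSum (fun ω => (μ ω).toReal) 1 := by
  have h := ENNReal.hasSum_toReal (f := μ) μ.tsum_coe_ne_top
  rwa [← ENNReal.tsum_toReal_eq μ.apply_ne_top, μ.tsum_coe, ENNReal.toReal_one] at h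

end Expectation

/-! ### Conditional mutual information -/

section CondMutualInfo

variable {Ω α β γ ζ κ : Type*} (μ : PMF Ω)

/-- The ratio of probabilities whose expected logarithm is `I(A; B | C)`. -/
def infoRatio (A : Ω → α) (B : Ω → β) (C : Ω → γ) (ω : Ω) : ℝ :=
  (μ.probAt (fun ω => (A ω, B ω, C ω)) ω).toReal * (μ.probAt C ω).toReal /
    ((μ.probAt (fun ω => (A ω, C ω)) ω).toReal * (μ.probAt (fun ω => (B ω, C ω)) ω).toReal)

/-- Informations with different alphabets become expectations over one space `Ω`, where their
integrands can be compared pointwise. -/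
theorem condMutualInfo_eq_tsum (A : Ω → α) (B : Ω → β) (C : Ω → γ) :
    condMutualInfo μ A B C = ∑' ω, (μ ω).toReal * Real.logb 2 (infoRatio μ A B C ω) :=
  PMF.tsum_map_mul_real μ (fun ω => (A ω, B ω, C ω)) fun t =>
    Real.logb 2
        (((μ.map fun ω => (A ω, B ω, C ω)) t).toReal * ((μ.map C) t.2.2).toReal /
          (((μ.map fun ω => (A ω, C ω)) (t.1, t.2.2)).toReal *
            ((μ.map fun ω => (B ω, C ω)) (t.2.1, t.2.2)).toReal))

theorem condMutualInfo_map {Ω' : Type*} (g : Ω' → Ω) (μ : PMF Ω') (A : Ω → α) (B : Ω → β)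
    (C : Ω → γ) : condMutualInfo (μ.map g) A B C =
      condMutualInfo μ (fun ω => A (g ω)) (fun ω => B (g ω)) (fun ω => C (g ω)) := by
  simp only [condMutualInfo, PMF.map_comp, Function.comp_def]

variable {μ}

theorem infoRatio_pos (A : Ω → α) (B : Ω → β) (C : Ω → γ) {ω : Ω} (h : μ ω ≠ 0) :
    0 < infoRatio μ A B C ω := by
  unfold infoRatio
  exact div_pos (mul_pos (PMF.probAt_toReal_pos h) (PMF.probAt_toReal_pos h))
    (mul_pos (PMF.probAt_toReal_pos h) (PMF.probAt_toReal_pos h))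

theorem logb_two_le {t : ℝ} (ht : 0 < t) : Real.logb 2 t ≤ (t - 1) / Real.log 2 := by
  rw [Real.logb]
  exact div_le_div_of_nonneg_right (Real.log_le_sub_one_of_pos ht)
    (Real.log_nonneg (by norm_num))

variable (μ) in
/-- The joint law which `A`, `B`, `C` would have if `A` and `B` were independent given `C`. -/
def condIndepLaw (A : Ω → α) (B : Ω → β) (C : Ω → γ) (t : α × β × γ) : ℝ≥0∞ :=
  μ.map (fun ω => (A ω, C ω)) (t.1, t.2.2) * μ.map (fun ω => (B ω, C ω)) (t.2.1, t.2.2) /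
    μ.map C t.2.2

theorem tsum_condIndepLaw_le (A : Ω → α) (B : Ω → β) (C : Ω → γ) :
    ∑' t, condIndepLaw μ A B C t ≤ 1 := by
  rw [ENNReal.tsum_prod']
  simp_rw [ENNReal.tsum_prod']
  rw [ENNReal.tsum_comm]
  have h : ∀ b, ∑' a, ∑' c, condIndepLaw μ A B C (a, b, c) ≤
      ∑' c, μ.map (fun ω => (B ω, C ω)) (b, c) := fun b => by
    rw [ENNReal.tsum_comm]
    refine ENNReal.tsum_le_tsum fun c => ?_
    simp only [condIndepLaw, div_eq_mul_inv]
    rw [ENNReal.tsum_mul_right, ENNReal.tsum_mul_right, PMF.tsum_map_pair, mul_comm, ← mul_assoc]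
    exact mul_le_of_le_one_left' (ENNReal.inv_mul_le_one _)
  refine (ENNReal.tsum_le_tsum h).trans ?_
  rw [← ENNReal.tsum_prod (f := fun b c => μ.map (fun ω => (B ω, C ω)) (b, c))]
  exact (PMF.tsum_coe _).le

theorem inv_infoRatio_eq (A : Ω → α) (B : Ω → β) (C : Ω → γ) (ω : Ω) :
    (infoRatio μ A B C ω)⁻¹ = (condIndepLaw μ A B C (A ω, B ω, C ω)).toReal /
      (μ.probAt (fun ω => (A ω, B ω, C ω)) ω).toReal := by
  simp only [infoRatio, condIndepLaw, PMF.probAt, ENNReal.toReal_mul, ENNReal.toReal_div]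
  rw [inv_div, div_div, mul_comm (ENNReal.toReal (μ.map C (C ω)))]

theorem summable_inv_infoRatio (A : Ω → α) (B : Ω → β) (C : Ω → γ) :
    Summable fun ω => (μ ω).toReal * (infoRatio μ A B C ω)⁻¹ := by
  simp_rw [inv_infoRatio_eq]
  exact PMF.summable_mul_div_probAt _
    (ne_top_of_le_ne_top ENNReal.one_ne_top (tsum_condIndepLaw_le A B C))

theorem tsum_inv_infoRatio_le (A : Ω → α) (B : Ω → β) (C : Ω → γ) :
    ∑' ω, (μ ω).toReal * (infoRatio μ A B C ω)⁻¹ ≤ 1 := by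
  simp_rw [inv_infoRatio_eq]
  exact PMF.tsum_mul_div_probAt_le_one _ (tsum_condIndepLaw_le A B C)

theorem one_sub_inv_infoRatio_le (A : Ω → α) (B : Ω → β) (C : Ω → γ) {ω : Ω} (h : μ ω ≠ 0) :
    (1 - (infoRatio μ A B C ω)⁻¹) / Real.log 2 ≤ Real.logb 2 (infoRatio μ A B C ω) := by
  have h1 := logb_two_le (inv_pos.2 (infoRatio_pos A B C h))
  rw [Real.logb_inv] at h1
  rw [← neg_sub, neg_div]
  linarith

/-- The minorant `(1 - 1 / ratio) / log 2` is always summable, so convergence can only fail from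
above. -/
theorem summable_infoRatio_of_le (A : Ω → α) (B : Ω → β) (C : Ω → γ) {U : Ω → ℝ}
    (hU : Summable fun ω => (μ ω).toReal * U ω)
    (hle : ∀ ω, μ ω ≠ 0 → Real.logb 2 (infoRatio μ A B C ω) ≤ U ω) :
    Summable fun ω => (μ ω).toReal * Real.logb 2 (infoRatio μ A B C ω) := by
  have hL : Summable fun ω => (μ ω).toReal * ((1 - (infoRatio μ A B C ω)⁻¹) / Real.log 2) := by
    have h := ((PMF.hasSum_toReal μ).summable.sub
      (summable_inv_infoRatio (μ := μ) A B C)).div_const (Real.log 2)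
    refine h.congr fun ω => ?_
    ring
  refine Summable.of_norm_bounded (hL.abs.add hU.abs) fun ω => ?_
  by_cases h : μ ω = 0
  · simp [h]
  have h0 : 0 ≤ (μ ω).toReal := ENNReal.toReal_nonneg
  have h1 := mul_le_mul_of_nonneg_left (one_sub_inv_infoRatio_le A B C h) h0
  have h2 := mul_le_mul_of_nonneg_left (hle ω h) h0
  rw [Real.norm_eq_abs, abs_le]
  constructor
  · linarith [neg_abs_le ((μ ω).toReal * ((1 - (infoRatio μ A B C ω)⁻¹) / Real.log 2)),
      abs_nonneg ((μ ω).toReal * U ω)]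
  · linarith [le_abs_self ((μ ω).toReal * U ω),
      abs_nonneg ((μ ω).toReal * ((1 - (infoRatio μ A B C ω)⁻¹) / Real.log 2))]

theorem infoRatio_le_div (A : Ω → α) (B : Ω → β) (C : Ω → γ) {ω : Ω} (h : μ ω ≠ 0) :
    infoRatio μ A B C ω ≤
      (μ.probAt C ω).toReal / (μ.probAt (fun ω => (A ω, C ω)) ω).toReal := by
  have h1 : (μ.probAt (fun ω => (A ω, B ω, C ω)) ω).toReal ≤
      (μ.probAt (fun ω => (B ω, C ω)) ω).toReal :=
    ENNReal.toReal_mono PMF.probAt_ne_top (PMF.probAt_mono fun ω' h' => (Prod.ext_iff.1 h').2)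
  have hC := PMF.probAt_toReal_pos (A := C) h
  have hAC := PMF.probAt_toReal_pos (A := fun ω => (A ω, C ω)) h
  have hBC := PMF.probAt_toReal_pos (A := fun ω => (B ω, C ω)) h
  unfold infoRatio
  rw [div_le_div_iff₀ (mul_pos hAC hBC) hAC]
  nlinarith [mul_le_mul_of_nonneg_left h1 (mul_pos hC hAC).le]

/-- The defining series of `I(A; B | C)` converges if `A` has a finite alphabet. -/
theorem summable_infoRatio_of_finite [Finite α] (A : Ω → α) (B : Ω → β)
    (C : Ω → γ) : Summable fun ω => (μ ω).toReal * Real.logb 2 (infoRatio μ A B C ω) := by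
  have := Fintype.ofFinite α
  have h1 : Summable fun ω => (μ ω).toReal *
      ((μ.map C (C ω)).toReal / (μ.probAt (fun ω => (A ω, C ω)) ω).toReal) := by
    -- With `N (a, c) = P(c)` the total mass is the cardinality of `α`, the only place where
    -- finiteness enters.
    refine PMF.summable_mul_div_probAt (fun ω => (A ω, C ω)) (N := fun t => μ.map C t.2) ?_
    rw [ENNReal.tsum_prod']
    simp only [PMF.tsum_coe, tsum_fintype, Finset.sum_const, nsmul_eq_mul, mul_one]
    exact ENNReal.natCast_ne_top _
  have h2 := (h1.sub (PMF.hasSum_toReal μ).summable).div_const (Real.log 2)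
  refine summable_infoRatio_of_le A B C (U := fun ω =>
    ((μ.map C (C ω)).toReal / (μ.probAt (fun ω => (A ω, C ω)) ω).toReal - 1) / Real.log 2)
    (h2.congr fun ω => by ring) fun ω h => ?_
  refine (logb_two_le (infoRatio_pos A B C h)).trans ?_
  exact div_le_div_of_nonneg_right (sub_le_sub_right (infoRatio_le_div A B C h) 1)
    (Real.log_nonneg (by norm_num))

/-- Averaging `log R ≥ 1 - 1 / R` suffices, since `1 / R` has expectation at most one. -/
theorem condMutualInfo_nonneg [Finite α] (A : Ω → α) (B : Ω → β) (C : Ω → γ) :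
    0 ≤ condMutualInfo μ A B C := by
  rw [condMutualInfo_eq_tsum]
  have h := (((PMF.hasSum_toReal μ).sub
    (summable_inv_infoRatio (μ := μ) A B C).hasSum).div_const (Real.log 2))
  refine (div_nonneg (sub_nonneg.2 (tsum_inv_infoRatio_le A B C))
    (Real.log_nonneg (by norm_num))).trans
    (hasSum_le (fun ω => ?_) h (summable_infoRatio_of_finite A B C).hasSum)
  by_cases h : μ ω = 0
  · simp [h]
  refine le_of_eq_of_le ?_ (mul_le_mul_of_nonneg_left (one_sub_inv_infoRatio_le A B C h)
    ENNReal.toReal_nonneg)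
  ring

/-- If `I(A; B | C) = 0`, then `A` and `B` are independent given `C`. -/
theorem map_eq_condIndepLaw [Finite α] {A : Ω → α} {B : Ω → β} {C : Ω → γ}
    (h0 : condMutualInfo μ A B C ≤ 0) (t : α × β × γ) :
    μ.map (fun ω => (A ω, B ω, C ω)) t = condIndepLaw μ A B C t := by
  have hlog : 0 < Real.log 2 := Real.log_pos (by norm_num)
  rw [condMutualInfo_eq_tsum] at h0
  have hs := (summable_infoRatio_of_finite (μ := μ) A B C).hasSum.sub
    (((PMF.hasSum_toReal μ).sub
    (summable_inv_infoRatio (μ := μ) A B C).hasSum).div_const (Real.log 2))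
  have hnn : ∀ ω, 0 ≤ (μ ω).toReal * Real.logb 2 (infoRatio μ A B C ω) -
      ((μ ω).toReal - (μ ω).toReal * (infoRatio μ A B C ω)⁻¹) / Real.log 2 := fun ω => by
    by_cases h : μ ω = 0
    · simp [h]
    refine sub_nonneg.2 (le_of_eq_of_le ?_ (mul_le_mul_of_nonneg_left
      (one_sub_inv_infoRatio_le A B C h) ENNReal.toReal_nonneg))
    ring
  -- Vanishing information is the equality case: the average of the nonnegative gap between `log R`
  -- and `1 - 1 / R` is zero, so `R = 1` wherever `μ` is positive.
  have hz : ∑' ω, (μ ω).toReal * Real.logb 2 (infoRatio μ A B C ω) -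
      (1 - ∑' ω, (μ ω).toReal * (infoRatio μ A B C ω)⁻¹) / Real.log 2 = 0 := by
    refine le_antisymm ?_ (hs.nonneg hnn)
    have := div_nonneg (sub_nonneg.2 (tsum_inv_infoRatio_le (μ := μ) A B C)) hlog.le
    linarith
  rw [hz, hasSum_zero_iff_of_nonneg hnn] at hs
  have hratio : ∀ ω, μ ω ≠ 0 → infoRatio μ A B C ω = 1 := fun ω h => by
    by_contra hne
    have hpos := infoRatio_pos A B C h
    have h1 := Real.log_lt_sub_one_of_pos (inv_pos.2 hpos) (by simpa using hne)
    rw [Real.log_inv] at h1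
    have h2 : (μ ω).toReal * Real.logb 2 (infoRatio μ A B C ω) -
      ((μ ω).toReal - (μ ω).toReal * (infoRatio μ A B C ω)⁻¹) / Real.log 2 = 0 := congrFun hs ω
    have h3 : (μ ω).toReal * Real.logb 2 (infoRatio μ A B C ω) -
      ((μ ω).toReal - (μ ω).toReal * (infoRatio μ A B C ω)⁻¹) / Real.log 2 =
      (μ ω).toReal / Real.log 2 *
        (Real.log (infoRatio μ A B C ω) - 1 + (infoRatio μ A B C ω)⁻¹) := by
      rw [Real.logb]
      field_simp
      ring
    have h4 : 0 < (μ ω).toReal / Real.log 2 :=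
      div_pos (ENNReal.toReal_pos h (μ.apply_ne_top ω)) hlog
    rw [h3] at h2
    rcases mul_eq_zero.1 h2 with h5 | h5 <;> linarith
  have hle : ∀ t, μ.map (fun ω => (A ω, B ω, C ω)) t ≤ condIndepLaw μ A B C t := fun t => by
    by_cases ht : μ.map (fun ω => (A ω, B ω, C ω)) t = 0
    · simp [ht]
    rw [← ne_eq, ← PMF.mem_support_iff, PMF.mem_support_map_iff] at ht
    obtain ⟨ω, hω, rfl⟩ := ht
    have h1 := inv_infoRatio_eq (μ := μ) A B C ω
    rw [hratio ω hω, inv_one, eq_comm, div_eq_one_iff_eq (PMF.probAt_toReal_pos hω).ne',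
      ENNReal.toReal_eq_toReal_iff' (ENNReal.ne_top_of_tsum_ne_top (ne_top_of_le_ne_top
        ENNReal.one_ne_top (tsum_condIndepLaw_le A B C)) _) PMF.probAt_ne_top] at h1
    exact h1.ge
  -- The true law has mass one and lies pointwise below a law of mass at most one, so no inequality
  -- can be strict.
  by_contra hne
  have := ENNReal.tsum_lt_tsum (PMF.tsum_coe_ne_top _) hle (lt_of_le_of_ne (hle t) hne)
  rw [PMF.tsum_coe] at this
  exact absurd (tsum_condIndepLaw_le A B C) this.not_ge

/-- Every marginal is again a product of `F`, `G` or their sums, and the likelihood ratio cancels to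
`1`. The integrand vanishes pointwise, so no alphabet has to be finite. -/
theorem condMutualInfo_eq_zero_of_factor {A : Ω → α} {B : Ω → β} {C : Ω → γ}
    (F : α → γ → ℝ≥0∞) (G : β → γ → ℝ≥0∞)
    (h : ∀ a b c, μ.map (fun ω => (A ω, B ω, C ω)) (a, b, c) = F a c * G b c) :
    condMutualInfo μ A B C = 0 := by
  have hBC : ∀ b c, μ.map (fun ω => (B ω, C ω)) (b, c) = (∑' a, F a c) * G b c := fun b c => by
    rw [← PMF.tsum_map_pair A (fun ω => (B ω, C ω)), ← ENNReal.tsum_mul_right]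
    exact tsum_congr fun a => h a b c
  have hAC : ∀ a c, μ.map (fun ω => (A ω, C ω)) (a, c) = F a c * ∑' b, G b c := fun a c => by
    rw [← PMF.tsum_map_pair B (fun ω => (A ω, C ω)), ← ENNReal.tsum_mul_left]
    refine tsum_congr fun b => ?_
    rw [← h]
    classical
    rw [PMF.map_apply, PMF.map_apply]
    refine tsum_congr fun ω => ?_
    congr 1
    simp only [Prod.mk.injEq, eq_iff_iff]
    tauto
  have hC : ∀ c, μ.map C c = (∑' a, F a c) * ∑' b, G b c := fun c => by
    rw [← PMF.tsum_map_pair B C, ← ENNReal.tsum_mul_left]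
    exact tsum_congr fun b => hBC b c
  rw [condMutualInfo_eq_tsum]
  refine (tsum_congr fun ω => ?_).trans tsum_zero
  by_cases hω : μ ω = 0
  · simp [hω]
  have hden := mul_pos (PMF.probAt_toReal_pos (A := fun ω => (A ω, C ω)) hω)
    (PMF.probAt_toReal_pos (A := fun ω => (B ω, C ω)) hω)
  have : infoRatio μ A B C ω = 1 := by
    unfold infoRatio
    rw [div_eq_one_iff_eq hden.ne']
    simp only [PMF.probAt, ← ENNReal.toReal_mul, h, hAC, hBC, hC]
    congr 1
    ring
  rw [this, Real.logb_one, mul_zero]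

/-- A message `Q` of which only `n Q` bits depend on `Y` when `K` and `X` are known
contributes at most the expectation of `n Q` to the conditional mutual information. -/
theorem condMutualInfo_le_add [Finite β] [DecidableEq κ] (X : Ω → α) (Y : Ω → β) (Z : Ω → ζ) (Q : Ω → γ)
    (k : γ → κ) (n : γ → ℕ) (g : α → γ → ζ → ℝ≥0∞) {ρ : ℝ}
    (hg : ∀ x k₀, ∑' c, ∑' z, (if k c = k₀ then g x c z else 0) ≤ 1)
    (hle : ∀ ω, μ ω ≠ 0 → μ.probAt (fun ω => (X ω, Y ω, Z ω, Q ω)) ω ≤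
      μ.probAt (fun ω => (X ω, Y ω, k (Q ω))) ω * (g (X ω) (Q ω) (Z ω) * 2 ^ n (Q ω)))
    (hρ : 0 ≤ ρ) (hn : ∑' ω, μ ω * n (Q ω) ≤ ENNReal.ofReal ρ) :
    condMutualInfo μ (fun ω => (Y ω, Z ω)) Q (fun ω => (X ω, Z ω)) ≤
      condMutualInfo μ Y (fun ω => k (Q ω)) X + ρ := by
  classical
  -- A candidate law for `(X, Q, Z)`: draw `X` and the known part `k Q` from their true law, and the
  -- rest from `g`. By `hg` its mass is at most one.
  set N : α × γ × ζ → ℝ≥0∞ := fun t =>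
    μ.map (fun ω => (X ω, k (Q ω))) (t.1, k t.2.1) * g t.1 t.2.1 t.2.2 with hNdef
  have hN : ∑' t, N t ≤ 1 := by
    have h1 : ∀ x c z, N (x, c, z) = ∑' k₀, μ.map (fun ω => (X ω, k (Q ω))) (x, k₀) *
        (if k c = k₀ then g x c z else 0) := fun x c z => by
      rw [tsum_eq_single (k c) (fun k₀ hk => by simp [hk.symm])]
      simp [hNdef]
    rw [ENNReal.tsum_prod']
    simp_rw [ENNReal.tsum_prod', h1]
    have h2 : ∀ x, ∑' c, ∑' z, ∑' k₀, μ.map (fun ω => (X ω, k (Q ω))) (x, k₀) *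
        (if k c = k₀ then g x c z else 0) ≤ ∑' k₀, μ.map (fun ω => (X ω, k (Q ω))) (x, k₀) := by
      intro x
      have h3 : ∀ c, ∑' z, ∑' k₀, μ.map (fun ω => (X ω, k (Q ω))) (x, k₀) *
          (if k c = k₀ then g x c z else 0) = ∑' k₀, ∑' z,
            μ.map (fun ω => (X ω, k (Q ω))) (x, k₀) * (if k c = k₀ then g x c z else 0) :=
        fun c => ENNReal.tsum_comm
      simp_rw [h3]
      rw [ENNReal.tsum_comm]
      refine ENNReal.tsum_le_tsum fun k₀ => ?_
      simp_rw [ENNReal.tsum_mul_left]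
      exact mul_le_of_le_one_right' (hg x k₀)
    refine (ENNReal.tsum_le_tsum h2).trans ?_
    rw [← ENNReal.tsum_prod (f := fun x k₀ => μ.map (fun ω => (X ω, k (Q ω))) (x, k₀))]
    exact (PMF.tsum_coe _).le
  have hN' := ne_top_of_le_ne_top ENNReal.one_ne_top hN
  -- The expected logarithm of `t₁` is `-I(Y; Z | X)`, and that of `t₂` is minus a relative entropy
  -- with respect to `N`. Only the fact that both have expectation at most one is used.
  set t₁ : Ω → ℝ := fun ω => (infoRatio μ Y Z X ω)⁻¹ with ht₁
  set t₂ : Ω → ℝ := fun ω =>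
    (N (X ω, Q ω, Z ω)).toReal / (μ.probAt (fun ω => (X ω, Q ω, Z ω)) ω).toReal with ht₂
  have hs₁ : Summable fun ω => (μ ω).toReal * t₁ ω := summable_inv_infoRatio Y Z X
  have hs₂ : Summable fun ω => (μ ω).toReal * t₂ ω := PMF.summable_mul_div_probAt _ hN'
  have hle₁ : ∑' ω, (μ ω).toReal * t₁ ω ≤ 1 := tsum_inv_infoRatio_le Y Z X
  have hle₂ : ∑' ω, (μ ω).toReal * t₂ ω ≤ 1 := PMF.tsum_mul_div_probAt_le_one _ hN
  have hntop := ne_top_of_le_ne_top ENNReal.ofReal_ne_top hn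
  have hsn : Summable fun ω => (μ ω).toReal * (n (Q ω) : ℝ) := by
    simpa [ENNReal.toReal_mul] using ENNReal.summable_toReal hntop
  have hlen : ∑' ω, (μ ω).toReal * (n (Q ω) : ℝ) ≤ ρ := by
    have h := ENNReal.toReal_le_of_le_ofReal hρ hn
    rw [ENNReal.tsum_toReal_eq (ENNReal.ne_top_of_tsum_ne_top hntop)] at h
    simpa [ENNReal.toReal_mul] using h
  have hs₀ := summable_infoRatio_of_finite (μ := μ) Y (fun ω => k (Q ω)) X
  have hlog : 0 < Real.log 2 := Real.log_pos (by norm_num)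
  have hnn := condMutualInfo_nonneg (μ := μ) Y (fun ω => k (Q ω)) X
  rw [condMutualInfo_eq_tsum μ (fun ω => (Y ω, Z ω))]
  -- If the series diverges, its default value `0` is below the nonnegative right-hand side.
  by_cases hs : Summable fun ω => (μ ω).toReal *
    Real.logb 2 (infoRatio μ (fun ω => (Y ω, Z ω)) Q (fun ω => (X ω, Z ω)) ω)
  swap
  · rw [tsum_eq_zero_of_not_summable hs]
    linarith
  rw [condMutualInfo_eq_tsum]
  have hsum := (hs₀.hasSum.add hsn.hasSum).add
    (((hs₁.hasSum.sub (PMF.hasSum_toReal μ)).add (hs₂.hasSum.sub (PMF.hasSum_toReal μ))).div_const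
      (Real.log 2))
  refine (hasSum_le (fun ω => ?_) hs.hasSum hsum).trans ?_
  swap
  · have : (∑' ω, (μ ω).toReal * t₁ ω - 1 + (∑' ω, (μ ω).toReal * t₂ ω - 1)) / Real.log 2 ≤ 0 :=
      div_nonpos_of_nonpos_of_nonneg (by linarith) hlog.le
    linarith
  by_cases hω : μ ω = 0
  · simp [hω]
  have e₁ : μ.probAt (fun ω => ((Y ω, Z ω), Q ω, (X ω, Z ω))) ω =
      μ.probAt (fun ω => (X ω, Y ω, Z ω, Q ω)) ω :=
    PMF.probAt_congr fun ω' => by simp only [Prod.mk.injEq]; tauto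
  have e₂ : μ.probAt (fun ω => ((Y ω, Z ω), (X ω, Z ω))) ω =
      μ.probAt (fun ω => (Y ω, Z ω, X ω)) ω :=
    PMF.probAt_congr fun ω' => by simp only [Prod.mk.injEq]; tauto
  have e₃ : μ.probAt (fun ω => (Q ω, (X ω, Z ω))) ω =
      μ.probAt (fun ω => (X ω, Q ω, Z ω)) ω :=
    PMF.probAt_congr fun ω' => by simp only [Prod.mk.injEq]; tauto
  have e₄ : μ.probAt (fun ω => (X ω, Z ω)) ω = μ.probAt (fun ω => (Z ω, X ω)) ω :=
    PMF.probAt_congr fun ω' => by simp only [Prod.mk.injEq]; tauto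
  have e₅ : μ.probAt (fun ω => (X ω, Y ω, k (Q ω))) ω =
      μ.probAt (fun ω => (Y ω, k (Q ω), X ω)) ω :=
    PMF.probAt_congr fun ω' => by simp only [Prod.mk.injEq]; tauto
  have e₆ : μ.probAt (fun ω => (X ω, k (Q ω))) ω = μ.probAt (fun ω => (k (Q ω), X ω)) ω :=
    PMF.probAt_congr fun ω' => by simp only [Prod.mk.injEq]; tauto
  have hgtop : g (X ω) (Q ω) (Z ω) ≠ ∞ := by
    refine ne_top_of_le_ne_top ENNReal.one_ne_top (le_trans ?_ (hg (X ω) (k (Q ω))))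
    refine le_trans ?_ (ENNReal.le_tsum (Q ω))
    refine le_trans ?_ (ENNReal.le_tsum (Z ω))
    simp
  have hle' := ENNReal.toReal_mono (ENNReal.mul_ne_top PMF.probAt_ne_top
    (ENNReal.mul_ne_top hgtop (ENNReal.pow_ne_top ENNReal.ofNat_ne_top))) (hle ω hω)
  simp only [ENNReal.toReal_mul, ENNReal.toReal_pow, ENNReal.toReal_ofNat] at hle'
  have hNω : (N (X ω, Q ω, Z ω)).toReal = (μ.probAt (fun ω => (X ω, k (Q ω))) ω).toReal *
    (g (X ω) (Q ω) (Z ω)).toReal := by rw [hNdef, ENNReal.toReal_mul]; rfl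
  have p₁ := PMF.probAt_toReal_pos (A := fun ω => (X ω, Y ω, Z ω, Q ω)) hω
  have p₂ := PMF.probAt_toReal_pos (A := fun ω => (Y ω, Z ω, X ω)) hω
  have p₃ := PMF.probAt_toReal_pos (A := fun ω => (X ω, Q ω, Z ω)) hω
  have p₄ := PMF.probAt_toReal_pos (A := fun ω => (Z ω, X ω)) hω
  have p₅ := PMF.probAt_toReal_pos (A := fun ω => (Y ω, k (Q ω), X ω)) hω
  have p₆ := PMF.probAt_toReal_pos (A := fun ω => (k (Q ω), X ω)) hω
  have p₇ := PMF.probAt_toReal_pos (A := fun ω => (Y ω, X ω)) hω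
  have p₈ := PMF.probAt_toReal_pos (A := X) hω
  rw [e₅] at hle'
  have hgpos : 0 < (g (X ω) (Q ω) (Z ω)).toReal := by
    refine lt_of_le_of_ne ENNReal.toReal_nonneg fun h => ?_
    rw [← h, zero_mul, mul_zero] at hle'
    linarith
  have hR₀ := infoRatio_pos Y (fun ω => k (Q ω)) X hω
  have ht₁pos : 0 < t₁ ω := inv_pos.2 (infoRatio_pos Y Z X hω)
  have ht₂pos : 0 < t₂ ω := by
    simp only [ht₂, hNω, e₆]
    positivity
  -- All marginals cancel exactly; the only inequality is the bound `hle` on the joint probability.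
  have hR : infoRatio μ (fun ω => (Y ω, Z ω)) Q (fun ω => (X ω, Z ω)) ω ≤
      infoRatio μ Y (fun ω => k (Q ω)) X ω * 2 ^ n (Q ω) * (t₁ ω * t₂ ω) := by
    simp only [ht₁, ht₂, hNω, infoRatio, e₁, e₂, e₃, e₄, e₆]
    rw [inv_div]
    generalize (μ.probAt (fun ω => (X ω, Y ω, Z ω, Q ω)) ω).toReal = x₁ at *
    generalize (μ.probAt (fun ω => (Y ω, Z ω, X ω)) ω).toReal = x₂ at *
    generalize (μ.probAt (fun ω => (X ω, Q ω, Z ω)) ω).toReal = x₃ at *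
    generalize (μ.probAt (fun ω => (Z ω, X ω)) ω).toReal = x₄ at *
    generalize (μ.probAt (fun ω => (Y ω, k (Q ω), X ω)) ω).toReal = x₅ at *
    generalize (μ.probAt (fun ω => (k (Q ω), X ω)) ω).toReal = x₆ at *
    generalize (μ.probAt (fun ω => (Y ω, X ω)) ω).toReal = x₇ at *
    generalize (μ.probAt X ω).toReal = x₈ at *
    generalize (g (X ω) (Q ω) (Z ω)).toReal = y at *
    have : x₅ * x₈ / (x₇ * x₆) * 2 ^ n (Q ω) * (x₇ * x₄ / (x₂ * x₈) * (x₆ * y / x₃)) =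
        x₅ * (y * 2 ^ n (Q ω)) * x₄ / (x₂ * x₃) := by
      field_simp
    rw [this]
    gcongr
  have h2 : Real.logb 2 (infoRatio μ (fun ω => (Y ω, Z ω)) Q (fun ω => (X ω, Z ω)) ω) ≤
      Real.logb 2 (infoRatio μ Y (fun ω => k (Q ω)) X ω) + n (Q ω) +
        ((t₁ ω - 1) / Real.log 2 + (t₂ ω - 1) / Real.log 2) := by
    refine (Real.logb_le_logb_of_le (by norm_num) (infoRatio_pos _ _ _ hω) hR).trans ?_
    rw [Real.logb_mul (by positivity) (by positivity), Real.logb_mul hR₀.ne' (by positivity),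
      Real.logb_mul ht₁pos.ne' ht₂pos.ne', Real.logb_pow, Real.logb_self_eq_one (by norm_num),
      mul_one]
    have := logb_two_le ht₁pos
    have := logb_two_le ht₂pos
    gcongr
  refine (mul_le_mul_of_nonneg_left h2 ENNReal.toReal_nonneg).trans_eq ?_
  ring

end CondMutualInfo

/-! ### Kraft's inequality for transcripts -/

section Kraft

/-- The empty word must be excluded: `{[]}` is prefix-free but not uniquely decodable. -/
theorem uniquelyDecodable_of_prefixFree {α : Type*} {S : Set (List α)} (h0 : [] ∉ S)
    (hS : ∀ m ∈ S, ∀ m' ∈ S, m <+: m' → m = m') : InformationTheory.UniquelyDecodable S := by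
  intro L₁
  induction L₁ with
  | nil =>
    intro L₂ _ h₂ h
    cases L₂ with
    | nil => rfl
    | cons w l =>
      have hw : w = [] := by
        have : w ++ l.flatten = [] := by simpa using h.symm
        exact (List.append_eq_nil_iff.1 this).1
      exact absurd (hw ▸ h₂ w (by simp)) h0
  | cons w₁ l₁ ih =>
    intro L₂ h₁ h₂ h
    cases L₂ with
    | nil =>
      have hw : w₁ = [] := by
        have : w₁ ++ l₁.flatten = [] := by simpa using h
        exact (List.append_eq_nil_iff.1 this).1
      exact absurd (hw ▸ h₁ w₁ (by simp)) h0
    | cons w₂ l₂ =>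
      rw [List.flatten_cons, List.flatten_cons] at h
      have hw : w₁ = w₂ := by
        rcases List.prefix_or_prefix_of_prefix (List.prefix_append w₁ l₁.flatten)
          (h ▸ List.prefix_append w₂ l₂.flatten) with hp | hp
        · exact hS _ (h₁ _ (by simp)) _ (h₂ _ (by simp)) hp
        · exact (hS _ (h₂ _ (by simp)) _ (h₁ _ (by simp)) hp).symm
      subst hw
      rw [ih l₂ (fun w hw => h₁ w (by simp [hw])) (fun w hw => h₂ w (by simp [hw]))
        (List.append_cancel_left h)]

open Classical in
/-- Kraft's inequality for a prefix-free, possibly infinite set of messages. -/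
theorem tsum_inv_two_pow_length_le_one {S : Set Message}
    (hS : ∀ m ∈ S, ∀ m' ∈ S, m <+: m' → m = m') :
    ∑' m : Message, (if m ∈ S then ((2 : ℝ≥0∞) ^ m.length)⁻¹ else 0) ≤ 1 := by
  by_cases h0 : [] ∈ S
  · rw [tsum_eq_single [] fun m hm => ?_]
    · simp [h0]
    · exact if_neg fun h => hm (hS _ h0 _ h (List.nil_prefix)).symm
  rw [ENNReal.tsum_eq_iSup_sum]
  refine iSup_le fun T => ?_
  rw [← Finset.sum_filter]
  have h := InformationTheory.kraft_mcmillan_inequality (S := T.filter (· ∈ S))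
    (uniquelyDecodable_of_prefixFree (by simp [h0])
      (fun m hm m' hm' => hS m (by simp_all) m' (by simp_all)))
  rw [Fintype.card_bool] at h
  have h' := ENNReal.ofReal_le_ofReal h
  rw [ENNReal.ofReal_sum_of_nonneg (fun _ _ => by positivity), ENNReal.ofReal_one] at h'
  refine le_of_eq_of_le (Finset.sum_congr rfl fun m _ => ?_) h'
  rw [ENNReal.ofReal_pow (by positivity), Nat.cast_ofNat, one_div,
    ENNReal.ofReal_inv_of_pos (by norm_num), ENNReal.ofReal_ofNat, ENNReal.inv_pow]

/-- Ending the interaction counts as an action of zero bits. It never competes with a message, so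
the sum is either at most the single weight `1` or a Kraft sum. -/
theorem SelfTerminating.tsum_le_one {S : Set (Option Message)} (hS : SelfTerminating S)
    [DecidablePred (· ∈ S)] :
    ∑' o : Option Message,
      (if o ∈ S then ((2 : ℝ≥0∞) ^ o.elim 0 List.length)⁻¹ else 0) ≤ 1 := by
  classical
  by_cases h0 : none ∈ S
  · rw [tsum_eq_single none fun o ho => if_neg fun h => ho (hS.1 h0 o h)]
    simp [h0]
  · refine le_of_eq_of_le ?_ (tsum_inv_two_pow_length_le_one (S := {m | some m ∈ S})
      fun m hm m' hm' => hS.2 m m' hm hm')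
    rw [← (Option.some_injective Message).tsum_eq]
    · refine tsum_congr fun m => ?_
      by_cases hm : some m ∈ S <;> simp [hm]
    · intro o ho
      cases o with
      | none => simp [h0] at ho
      | some m => exact ⟨m, rfl⟩

/-- The weight of a path in the tree of lists, where `ν h (some m)` is the weight of the step
from `h` to `m :: h`. -/
def pathWeight {M : Type*} (ν : List M → Option M → ℝ≥0∞) : List M → ℝ≥0∞
  | [] => 1
  | m :: h => pathWeight ν h * ν h (some m)

theorem tsum_option_ennreal {M : Type*} (f : Option M → ℝ≥0∞) :
    ∑' o, f o = f none + ∑' m, f (some m) := by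
  rw [← (Equiv.optionEquivSumPUnit.{0} M).symm.tsum_eq,
    ENNReal.summable.tsum_sum ENNReal.summable]
  simp [add_comm]

/-- Conservation of mass by depth: the weight `E n` ending at depth `n` and the weight `S (n + 1)`
continuing together come from `S n`. Telescoping from `S 0 = 1` bounds all the ended weight. -/
theorem tsum_pathWeight_mul_none_le_one {M : Type*} {ν : List M → Option M → ℝ≥0∞}
    (hν : ∀ h, ∑' o, ν h o ≤ 1) : ∑' h, pathWeight ν h * ν h none ≤ 1 := by
  classical
  set S : ℕ → ℝ≥0∞ := fun n => ∑' h : List M, if h.length = n then pathWeight ν h else 0 with hS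
  set E : ℕ → ℝ≥0∞ := fun n =>
    ∑' h : List M, if h.length = n then pathWeight ν h * ν h none else 0 with hE
  have hstep : ∀ n, E n + S (n + 1) ≤ S n := fun n => by
    have h1 : S (n + 1) = ∑' (h : List M) (m : M),
        if h.length = n then pathWeight ν h * ν h (some m) else 0 := by
      have hinj : Function.Injective fun t : List M × M => t.2 :: t.1 := fun s t hst => by
        simp only [List.cons.injEq] at hst
        exact Prod.ext hst.2 hst.1
      rw [← ENNReal.tsum_prod (f := fun (h : List M) m =>
        if h.length = n then pathWeight ν h * ν h (some m) else 0)]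
      simp only [hS]
      rw [← hinj.tsum_eq]
      · simp [pathWeight]
      · intro h hh
        cases h with
        | nil => simp at hh
        | cons m h => exact ⟨(h, m), rfl⟩
    rw [h1, ← ENNReal.tsum_add]
    refine ENNReal.tsum_le_tsum fun h => ?_
    by_cases hn : h.length = n
    · simp only [hn, if_true]
      rw [ENNReal.tsum_mul_left, ← mul_add, ← tsum_option_ennreal]
      exact mul_le_of_le_one_right' (hν h)
    · simp [hn]
  have hsum : ∀ n, ∑ i ∈ Finset.range n, E i + S n ≤ 1 := fun n => by
    induction n with
    | zero =>
      simp only [Finset.range_zero, Finset.sum_empty, zero_add, hS]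
      rw [tsum_eq_single [] fun h hh => if_neg fun h0 => hh (List.length_eq_zero_iff.1 h0)]
      simp [pathWeight]
    | succ n ih =>
      rw [Finset.sum_range_succ, add_assoc]
      exact (add_le_add_right (hstep n) _).trans ih
  have htot : ∑' h, pathWeight ν h * ν h none = ∑' n, E n := by
    rw [hE, ENNReal.tsum_comm]
    simp
  rw [htot]
  exact ENNReal.tsum_le_of_sum_range_le fun n => le_self_add.trans (hsum n)

end Kraft

/-! ### Transcript probabilities: Kraft bound, exchange of the parties, factorization -/

namespace Protocol

variable {X Y A B : Type*} (P : Protocol X Y A B)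

/-- A person who knows the input of party 1 can encode what party 2 sends with as many bits as
party 2 uses. -/
theorem exists_transcriptProb_le {p : PMF (X × Y)} (hP : P.IsSelfTerminating p) (x : X) :
    ∃ g : Transcript → ℝ≥0∞, ∑' h, g h ≤ 1 ∧
      ∀ y h, p (x, y) ≠ 0 → P.transcriptProb x y h ≤ g h * 2 ^ P.bits₂₁ h := by
  classical
  set S : Transcript → Set (Option Message) := fun h =>
    {o | ∃ y, p (x, y) ≠ 0 ∧ P.reachProb x y h ≠ 0 ∧ P.next x y h o ≠ 0} with hS
  -- Party 1's steps keep their true probabilities, which `x` determines; party 2's steps get Kraft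
  -- weights on the actions possible for some `y`. Hence `ν` does not depend on `y`.
  set ν : Transcript → Option Message → ℝ≥0∞ := fun h o =>
    if P.turnOfOne h then P.next₁ x h o
    else if o ∈ S h then ((2 : ℝ≥0∞) ^ o.elim 0 List.length)⁻¹ else 0 with hν
  have hν1 : ∀ h, ∑' o, ν h o ≤ 1 := fun h => by
    by_cases ht : P.turnOfOne h
    · simp only [hν, ht, if_true]
      exact (PMF.tsum_coe _).le
    · simp only [hν, ht]
      exact ((hP h).1 x).tsum_le_one
  have hnext : ∀ y h o, p (x, y) ≠ 0 → P.reachProb x y h ≠ 0 → P.next x y h o ≤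
      ν h o * 2 ^ (if P.turnOfOne h then 0 else o.elim 0 List.length) := fun y h o hp hr => by
    by_cases ht : P.turnOfOne h
    · simp [hν, next, ht]
    · by_cases ho : P.next x y h o = 0
      · simp [ho]
      have hoS : o ∈ S h := ⟨y, hp, hr, ho⟩
      simp only [hν, ht, hoS, if_true]
      rw [if_neg (by simp), if_neg (by simp),
        ENNReal.inv_mul_cancel (by simp) (ENNReal.pow_ne_top ENNReal.ofNat_ne_top)]
      exact PMF.coe_le_one _ _
  have hreach : ∀ y h, p (x, y) ≠ 0 →
      P.reachProb x y h ≤ pathWeight ν h * 2 ^ P.bits₂₁ h := fun y h hp => by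
    induction h with
    | nil => simp [reachProb, pathWeight, bits₂₁]
    | cons m h ih =>
      by_cases hr : P.reachProb x y h = 0
      · simp [reachProb, hr]
      calc P.reachProb x y (m :: h) = P.reachProb x y h * P.next x y h (some m) := rfl
        _ ≤ (pathWeight ν h * 2 ^ P.bits₂₁ h) *
            (ν h (some m) * 2 ^ (if P.turnOfOne h then 0 else m.length)) :=
          mul_le_mul' ih (hnext y h (some m) hp hr)
        _ = pathWeight ν (m :: h) * 2 ^ P.bits₂₁ (m :: h) := by
          simp only [pathWeight, bits₂₁, pow_add]
          ring
  refine ⟨fun h => pathWeight ν h * ν h none, tsum_pathWeight_mul_none_le_one hν1,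
    fun y h hp => ?_⟩
  by_cases hr : P.reachProb x y h = 0
  · simp [transcriptProb, hr]
  calc P.transcriptProb x y h = P.reachProb x y h * P.next x y h none := rfl
    _ ≤ (pathWeight ν h * 2 ^ P.bits₂₁ h) * (ν h none * 2 ^ 0) :=
      mul_le_mul' (hreach y h hp) (by simpa using hnext y h none hp hr)
    _ = pathWeight ν h * ν h none * 2 ^ P.bits₂₁ h := by ring

/-- The protocol with the roles of the parties exchanged. -/
def swap : Protocol Y X B A where
  firstIsOne := !P.firstIsOne
  next₁ := P.next₂
  next₂ := P.next₁
  out₁ := P.out₂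
  out₂ := P.out₁

theorem turnOfOne_swap (h : Transcript) : P.swap.turnOfOne h = !P.turnOfOne h := by
  induction h with
  | nil => rfl
  | cons m h ih => simp [turnOfOne, ih]

theorem next_swap (x : X) (y : Y) (h : Transcript) : P.swap.next y x h = P.next x y h := by
  unfold next
  rw [turnOfOne_swap]
  by_cases ht : P.turnOfOne h <;> simp [ht, swap]

theorem reachProb_swap (x : X) (y : Y) (h : Transcript) :
    P.swap.reachProb y x h = P.reachProb x y h := by
  induction h with
  | nil => rfl
  | cons m h ih => simp only [reachProb, ih, next_swap]

theorem transcriptProb_swap (x : X) (y : Y) (h : Transcript) :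
    P.swap.transcriptProb y x h = P.transcriptProb x y h := by
  simp only [transcriptProb, reachProb_swap, next_swap]

theorem bits₂₁_swap (h : Transcript) : P.swap.bits₂₁ h = P.bits₁₂ h := by
  induction h with
  | nil => rfl
  | cons m h ih =>
    simp only [bits₂₁, bits₁₂, ih, turnOfOne_swap]
    by_cases ht : P.turnOfOne h <;> simp [ht]

theorem map_swap_apply (p : PMF (X × Y)) (x : X) (y : Y) : p.map Prod.swap (y, x) = p (x, y) := by
  classical
  rw [PMF.map_apply, tsum_eq_single (x, y)]
  · simp
  · rintro ⟨x', y'⟩ h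
    refine if_neg fun h' => h ?_
    simp only [Prod.swap_prod_mk, Prod.mk.injEq] at h'
    simp [h'.1, h'.2]

variable {P} in
theorem IsSelfTerminating.swap {p : PMF (X × Y)} (hP : P.IsSelfTerminating p) :
    P.swap.IsSelfTerminating (p.map Prod.swap) := fun h => by
  simp only [map_swap_apply, reachProb_swap, next_swap]
  exact ⟨(hP h).2, (hP h).1⟩

/-- Rectangle property: each message's probability depends only on its sender's input and the
transcript, so each factor can be credited to one party. -/
theorem exists_reachProb_eq_mul :
    ∃ (a : X → Transcript → ℝ≥0∞) (b : Y → Transcript → ℝ≥0∞),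
      ∀ x y h, P.reachProb x y h = a x h * b y h := by
  refine ⟨fun x => pathWeight fun h o => if P.turnOfOne h then P.next₁ x h o else 1,
    fun y => pathWeight fun h o => if P.turnOfOne h then 1 else P.next₂ y h o, fun x y h => ?_⟩
  induction h with
  | nil => simp [reachProb, pathWeight]
  | cons m h ih =>
    simp only [reachProb, pathWeight, ih, next]
    by_cases ht : P.turnOfOne h
    · simp only [ht, if_true]
      ring
    · simp only [ht]
      simp
      ring

theorem exists_transcriptProb_eq_mul :
    ∃ (a : X → Transcript → ℝ≥0∞) (b : Y → Transcript → ℝ≥0∞),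
      ∀ x y h, P.transcriptProb x y h = a x h * b y h := by
  obtain ⟨a, b, h⟩ := P.exists_reachProb_eq_mul
  refine ⟨fun x h => a x h * if P.turnOfOne h then P.next₁ x h none else 1,
    fun y h => b y h * if P.turnOfOne h then 1 else P.next₂ y h none, fun x y t => ?_⟩
  rw [transcriptProb, h, next]
  by_cases ht : P.turnOfOne t
  · simp only [ht, if_true]
    ring
  · simp only [ht]
    simp
    ring

end Protocol

/-! ### Tension and protocols -/

section Marginals

variable {Ω α β υ : Type*}

theorem PMF.map_apply_of_injective (μ : PMF Ω) {g : Ω → υ} (hg : Function.Injective g) (ω : Ω) :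
    μ.map g (g ω) = μ ω := by
  classical
  rw [PMF.map_apply, tsum_eq_single ω fun ω' h => if_neg fun h' => h (hg h').symm, if_pos rfl]

theorem PMF.map_apply_eq_zero (μ : PMF Ω) {g : Ω → υ} {u : υ} (h : ∀ ω, g ω ≠ u) :
    μ.map g u = 0 := by
  rw [PMF.apply_eq_zero_iff, PMF.mem_support_map_iff]
  exact fun ⟨ω, _, hω⟩ => h ω hω

theorem PMF.map_fst_apply (μ : PMF (α × β)) (a : α) : μ.map Prod.fst a = ∑' b, μ (a, b) := by
  classical
  rw [PMF.map_apply, ENNReal.tsum_prod', tsum_eq_single a fun a' h => by simp [h.symm]]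
  simp

end Marginals

/-! ### Adjoining the transcript to the auxiliary variable -/

namespace Protocol

variable {X Y Z : Type*}

theorem Produces.apply_diag {P : Protocol X Y Z Z} {r : PMF ((X × Y) × Z)}
    (h : P.Produces (r.map Prod.fst) (r.map fun ω => (ω.1, (ω.2, ω.2)))) (x : X) (y : Y) (z : Z) :
    r.map Prod.fst (x, y) * ∑' t, P.transcriptProb x y t * (P.out₁ x t z * P.out₂ y t z) =
      r ((x, y), z) := by
  rw [← h]
  exact PMF.map_apply_of_injective r (g := fun ω => (ω.1, (ω.2, ω.2)))
    (fun ω ω' hω => by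
      simp only [Prod.mk.injEq] at hω
      exact Prod.ext hω.1 hω.2.1) ((x, y), z)

theorem Produces.apply_ne {P : Protocol X Y Z Z} {r : PMF ((X × Y) × Z)}
    (h : P.Produces (r.map Prod.fst) (r.map fun ω => (ω.1, (ω.2, ω.2)))) {x : X} {y : Y}
    (hp : r.map Prod.fst (x, y) ≠ 0) {a b : Z} (hab : a ≠ b) (t : Transcript) :
    P.transcriptProb x y t * (P.out₁ x t a * P.out₂ y t b) = 0 := by
  have h1 := h x y a b
  rw [PMF.map_apply_eq_zero _ fun ω hω => ?_, eq_comm, mul_eq_zero] at h1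
  · exact ENNReal.tsum_eq_zero.1 (h1.resolve_left hp) t
  · simp only [Prod.mk.injEq] at hω
    exact hab (hω.2.1.symm.trans hω.2.2)

/-- The prescribed law lives on the diagonal and has full mass, so termination and agreement of the
outputs are certain at every input of positive probability. -/
theorem Produces.tsum_tsum_eq_one {P : Protocol X Y Z Z} {r : PMF ((X × Y) × Z)}
    (h : P.Produces (r.map Prod.fst) (r.map fun ω => (ω.1, (ω.2, ω.2)))) {x : X} {y : Y}
    (hp : r.map Prod.fst (x, y) ≠ 0) :
    ∑' t, ∑' z, P.transcriptProb x y t * (P.out₁ x t z * P.out₂ y t z) = 1 := by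
  have h1 : r.map Prod.fst (x, y) *
      ∑' t, ∑' z, P.transcriptProb x y t * (P.out₁ x t z * P.out₂ y t z) =
      r.map Prod.fst (x, y) * 1 := by
    rw [ENNReal.tsum_comm, ← ENNReal.tsum_mul_left]
    simp_rw [h.apply_diag]
    rw [PMF.map_fst_apply, mul_one]
  exact (ENNReal.mul_right_inj hp (PMF.apply_ne_top _ _)).1 h1

theorem input_ne_zero_of_ne_zero {r : PMF ((X × Y) × Z)} {q : PMF ((X × Y) × ℕ)}
    (hq : q.map Prod.fst = r.map Prod.fst) {u : (X × Y) × ℕ}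
    (hu : q u ≠ 0) : r.map Prod.fst u.1 ≠ 0 := by
  rw [← hq, ← PMF.mem_support_iff, PMF.mem_support_map_iff]
  exact ⟨u, hu, rfl⟩

/-- The joint law of the inputs, of `Q`, of the transcript and of the common output, when `Q` and
the coins of the protocol are independent given the inputs. -/
def jointLaw (P : Protocol X Y Z Z) (r : PMF ((X × Y) × Z)) (q : PMF ((X × Y) × ℕ))
    (hq : q.map Prod.fst = r.map Prod.fst)
    (h : P.Produces (r.map Prod.fst) (r.map fun ω => (ω.1, (ω.2, ω.2)))) :
    PMF (((X × Y) × ℕ) × (Transcript × Z)) :=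
  ⟨fun ω => q ω.1 * (P.transcriptProb ω.1.1.1 ω.1.1.2 ω.2.1 *
    (P.out₁ ω.1.1.1 ω.2.1 ω.2.2 * P.out₂ ω.1.1.2 ω.2.1 ω.2.2)), by
    rw [ENNReal.summable.hasSum_iff, ENNReal.tsum_prod', ← q.tsum_coe]
    refine tsum_congr fun u => ?_
    dsimp only
    rw [ENNReal.tsum_mul_left, ENNReal.tsum_prod']
    by_cases hu : q u = 0
    · simp [hu]
    · rw [h.tsum_tsum_eq_one (input_ne_zero_of_ne_zero hq hu), mul_one]⟩

variable {P : Protocol X Y Z Z} {r : PMF ((X × Y) × Z)} {q : PMF ((X × Y) × ℕ)}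
  {hq : q.map Prod.fst = r.map Prod.fst}
  {h : P.Produces (r.map Prod.fst) (r.map fun ω => (ω.1, (ω.2, ω.2)))}

theorem jointLaw_apply (ω : ((X × Y) × ℕ) × (Transcript × Z)) :
    P.jointLaw r q hq h ω = q ω.1 * (P.transcriptProb ω.1.1.1 ω.1.1.2 ω.2.1 *
      (P.out₁ ω.1.1.1 ω.2.1 ω.2.2 * P.out₂ ω.1.1.2 ω.2.1 ω.2.2)) := rfl

theorem jointLaw_map_fst : (P.jointLaw r q hq h).map Prod.fst = q := by
  ext u
  rw [PMF.map_fst_apply]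
  simp_rw [jointLaw_apply]
  rw [ENNReal.tsum_mul_left, ENNReal.tsum_prod']
  by_cases hu : q u = 0
  · simp [hu]
  · rw [h.tsum_tsum_eq_one (input_ne_zero_of_ne_zero hq hu), mul_one]

theorem jointLaw_map_input_output :
    (P.jointLaw r q hq h).map (fun ω => (ω.1.1, ω.2.2)) = r := by
  classical
  ext ⟨⟨x, y⟩, z⟩
  rw [← h.apply_diag, ← hq, PMF.map_fst_apply, ← ENNReal.tsum_mul_right, PMF.map_apply,
    ENNReal.tsum_prod', ENNReal.tsum_prod', tsum_eq_single (x, y)]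
  · refine tsum_congr fun k => ?_
    rw [ENNReal.tsum_prod', ← ENNReal.tsum_mul_left]
    refine tsum_congr fun t => ?_
    rw [tsum_eq_single z fun z' hz => by simp [hz.symm]]
    simp [jointLaw_apply]
  · intro u hu
    simp [hu.symm]

theorem tsum_jointLaw_mul_le (n : Transcript → ℕ) :
    ∑' ω, P.jointLaw r q hq h ω * (n ω.2.1 : ℝ≥0∞) ≤
      ∑' xy : X × Y, r.map Prod.fst xy * ∑' t, P.transcriptProb xy.1 xy.2 t * (n t : ℝ≥0∞) := by
  rw [ENNReal.tsum_prod', ENNReal.tsum_prod']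
  refine ENNReal.tsum_le_tsum fun xy => ?_
  rw [← hq, PMF.map_fst_apply, ← ENNReal.tsum_mul_right]
  refine ENNReal.tsum_le_tsum fun k => ?_
  rw [ENNReal.tsum_prod', ← ENNReal.tsum_mul_left]
  refine ENNReal.tsum_le_tsum fun t => ?_
  -- Bounding `out₂` by `1` loses nothing that matters, as `out₁` already sums to one over `z`.
  calc ∑' z, P.jointLaw r q hq h ((xy, k), (t, z)) * (n t : ℝ≥0∞)
      ≤ ∑' z, q (xy, k) * (P.transcriptProb xy.1 xy.2 t * n t) * P.out₁ xy.1 t z := by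
        refine ENNReal.tsum_le_tsum fun z => ?_
        rw [jointLaw_apply]
        calc q (xy, k) * (P.transcriptProb xy.1 xy.2 t * (P.out₁ xy.1 t z * P.out₂ xy.2 t z)) * n t
            = q (xy, k) * (P.transcriptProb xy.1 xy.2 t * n t) * P.out₁ xy.1 t z *
              P.out₂ xy.2 t z := by ring
          _ ≤ _ := mul_le_of_le_one_right' (PMF.coe_le_one _ _)
    _ = _ := by rw [ENNReal.tsum_mul_left, PMF.tsum_coe, mul_one]

theorem condMutualInfo_jointLaw_eq_zero [Finite X] (e : ℕ ≃ ℕ × Transcript)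
    (h0 : condMutualInfo q (fun ω => ω.1.1) (fun ω => ω.1.2) (fun ω => ω.2) ≤ 0) :
    condMutualInfo (P.jointLaw r q hq h) (fun ω => (ω.1.1.1, ω.2.2)) (fun ω => (ω.1.1.2, ω.2.2))
      (fun ω => e.symm (ω.1.2, ω.2.1)) = 0 := by
  classical
  have hfac : ∀ x y k, q ((x, y), k) =
      q.map (fun ω => (ω.1.1, ω.2)) (x, k) * q.map (fun ω => (ω.1.2, ω.2)) (y, k) /
        q.map Prod.snd k := fun x y k => by
    have h1 := map_eq_condIndepLaw h0 (x, y, k)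
    have h2 : q.map (fun ω => (ω.1.1, ω.1.2, ω.2)) (x, y, k) = q ((x, y), k) :=
      PMF.map_apply_of_injective q (g := fun ω => (ω.1.1, ω.1.2, ω.2))
        (fun ω ω' hω => by
          simp only [Prod.mk.injEq] at hω
          exact Prod.ext (Prod.ext hω.1 hω.2.1) hω.2.2) ((x, y), k)
    rw [← h2, h1]
    rfl
  obtain ⟨α, β, hαβ⟩ := P.exists_transcriptProb_eq_mul
  refine condMutualInfo_eq_zero_of_factor
    (fun xa n => q.map (fun ω => (ω.1.1, ω.2)) (xa.1, (e n).1) *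
      (α xa.1 (e n).2 * P.out₁ xa.1 (e n).2 xa.2))
    (fun yb n => q.map (fun ω => (ω.1.2, ω.2)) (yb.1, (e n).1) / q.map Prod.snd (e n).1 *
      (β yb.1 (e n).2 * P.out₂ yb.1 (e n).2 yb.2)) ?_
  rintro ⟨x, a⟩ ⟨y, b⟩ n
  obtain ⟨⟨k, t⟩, rfl⟩ := e.symm.surjective n
  simp only [Equiv.apply_symm_apply]
  have hR : q.map (fun ω => (ω.1.1, ω.2)) (x, k) * (α x t * P.out₁ x t a) *
      (q.map (fun ω => (ω.1.2, ω.2)) (y, k) / q.map Prod.snd k * (β y t * P.out₂ y t b)) =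
      q ((x, y), k) * (P.transcriptProb x y t * (P.out₁ x t a * P.out₂ y t b)) := by
    rw [hfac, hαβ]
    simp only [div_eq_mul_inv]
    ring
  rw [hR]
  -- `Z` occurs in both `XZ` and `YZ`, so the factorization must also hold off the diagonal. There
  -- the product vanishes because the outputs never disagree.
  by_cases hab : a = b
  · subst hab
    exact PMF.map_apply_of_injective (P.jointLaw r q hq h)
      (g := fun ω => ((ω.1.1.1, ω.2.2), (ω.1.1.2, ω.2.2), e.symm (ω.1.2, ω.2.1)))
      (fun ω ω' hω => by
        simp only [Prod.mk.injEq, e.symm.injective.eq_iff] at hω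
        exact Prod.ext (Prod.ext (Prod.ext hω.1.1 hω.2.1.1) hω.2.2.1)
          (Prod.ext hω.2.2.2 hω.1.2)) (((x, y), k), (t, a))
  · rw [PMF.map_apply_eq_zero _ fun ω hω => ?_]
    · by_cases hu : q ((x, y), k) = 0
      · rw [hu, zero_mul]
      · rw [h.apply_ne (input_ne_zero_of_ne_zero hq hu) hab, mul_zero]
    · simp only [Prod.mk.injEq] at hω
      exact hab (hω.1.2.symm.trans hω.2.1.2)

theorem tsum_ite_fst_eq_le_one (e : ℕ ≃ ℕ × Transcript) (g : Transcript → ℝ≥0∞)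
    (hg : ∑' t, g t ≤ 1) (out : Transcript → PMF Z) (k₀ : ℕ) :
    ∑' c, ∑' z, (if (e c).1 = k₀ then g (e c).2 * out (e c).2 z else 0) ≤ 1 := by
  rw [e.tsum_eq fun s : ℕ × Transcript => ∑' z, (if s.1 = k₀ then g s.2 * out s.2 z else 0),
    ENNReal.tsum_prod', tsum_eq_single k₀ fun k hk => by simp [hk]]
  simpa [ENNReal.tsum_mul_left, PMF.tsum_coe] using hg

theorem probAt_jointLaw_eq (e : ℕ ≃ ℕ × Transcript) (ω : ((X × Y) × ℕ) × (Transcript × Z)) :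
    (P.jointLaw r q hq h).probAt (fun ω => (ω.1.1.1, ω.1.1.2, ω.2.2, e.symm (ω.1.2, ω.2.1))) ω =
      P.jointLaw r q hq h ω :=
  PMF.map_apply_of_injective (P.jointLaw r q hq h)
    (g := fun ω => (ω.1.1.1, ω.1.1.2, ω.2.2, e.symm (ω.1.2, ω.2.1)))
    (fun ω ω' hω => by
      simp only [Prod.mk.injEq, e.symm.injective.eq_iff] at hω
      exact Prod.ext (Prod.ext (Prod.ext hω.1 hω.2.1) hω.2.2.2.1)
        (Prod.ext hω.2.2.2.2 hω.2.2.1)) ω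

theorem probAt_jointLaw_input (e : ℕ ≃ ℕ × Transcript) (ω : ((X × Y) × ℕ) × (Transcript × Z)) :
    (P.jointLaw r q hq h).probAt
      (fun ω => (ω.1.1.1, ω.1.1.2, (e (e.symm (ω.1.2, ω.2.1))).1)) ω = q ω.1 := by
  rw [PMF.probAt_congr (B := Prod.fst) fun ω' => ?_, PMF.probAt, jointLaw_map_fst]
  simp [Prod.ext_iff, and_assoc]

/-- Given `x`, the transcript has the Kraft law `g x` and `z` is drawn by `out₁ x`; the factor `out₂
≤ 1` is dropped. The part `k` of the new variable is the old `Q`. -/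
theorem condMutualInfo_jointLaw_le₁ [Finite Y] (e : ℕ ≃ ℕ × Transcript)
    (hP : P.IsSelfTerminating (r.map Prod.fst)) {ρ : ℝ} (hρ : 0 ≤ ρ)
    (hrate : P.rate₂₁ (r.map Prod.fst) ≤ ENNReal.ofReal ρ) :
    condMutualInfo (P.jointLaw r q hq h) (fun ω => (ω.1.1.2, ω.2.2))
        (fun ω => e.symm (ω.1.2, ω.2.1)) (fun ω => (ω.1.1.1, ω.2.2)) ≤
      condMutualInfo q (fun ω => ω.1.2) (fun ω => ω.2) (fun ω => ω.1.1) + ρ := by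
  choose g hg hgle using P.exists_transcriptProb_le hP
  have hmain := condMutualInfo_le_add (μ := P.jointLaw r q hq h) (fun ω => ω.1.1.1)
    (fun ω => ω.1.1.2) (fun ω => ω.2.2) (fun ω => e.symm (ω.1.2, ω.2.1)) (fun c => (e c).1)
    (fun c => P.bits₂₁ (e c).2) (fun x c z => g x (e c).2 * P.out₁ x (e c).2 z)
    (fun x => tsum_ite_fst_eq_le_one e (g x) (hg x) (P.out₁ x)) (fun ω hω => ?_) hρ
    (le_trans (by simp only [Equiv.apply_symm_apply]; exact tsum_jointLaw_mul_le P.bits₂₁) hrate)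
  · refine hmain.trans_eq ?_
    conv_rhs => rw [← jointLaw_map_fst (P := P) (r := r) (q := q) (hq := hq) (h := h)]
    rw [condMutualInfo_map]
    simp
  · rw [probAt_jointLaw_eq, probAt_jointLaw_input, jointLaw_apply, Equiv.apply_symm_apply]
    refine mul_le_mul_right ?_ _
    have hu : q ω.1 ≠ 0 := fun h0 => hω (by rw [jointLaw_apply, h0, zero_mul])
    calc P.transcriptProb ω.1.1.1 ω.1.1.2 ω.2.1 *
          (P.out₁ ω.1.1.1 ω.2.1 ω.2.2 * P.out₂ ω.1.1.2 ω.2.1 ω.2.2)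
        ≤ (g ω.1.1.1 ω.2.1 * 2 ^ P.bits₂₁ ω.2.1) * (P.out₁ ω.1.1.1 ω.2.1 ω.2.2 * 1) :=
          mul_le_mul' (hgle _ _ _ (input_ne_zero_of_ne_zero hq hu))
            (mul_le_mul' le_rfl (PMF.coe_le_one _ _))
      _ = _ := by ring

theorem condMutualInfo_jointLaw_le₂ [Finite X] (e : ℕ ≃ ℕ × Transcript)
    (hP : P.IsSelfTerminating (r.map Prod.fst)) {ρ : ℝ} (hρ : 0 ≤ ρ)
    (hrate : P.rate₁₂ (r.map Prod.fst) ≤ ENNReal.ofReal ρ) :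
    condMutualInfo (P.jointLaw r q hq h) (fun ω => (ω.1.1.1, ω.2.2))
        (fun ω => e.symm (ω.1.2, ω.2.1)) (fun ω => (ω.1.1.2, ω.2.2)) ≤
      condMutualInfo q (fun ω => ω.1.1) (fun ω => ω.2) (fun ω => ω.1.2) + ρ := by
  choose g hg hgle using P.swap.exists_transcriptProb_le hP.swap
  simp only [map_swap_apply, transcriptProb_swap, bits₂₁_swap] at hgle
  have hmain := condMutualInfo_le_add (μ := P.jointLaw r q hq h) (fun ω => ω.1.1.2)
    (fun ω => ω.1.1.1) (fun ω => ω.2.2) (fun ω => e.symm (ω.1.2, ω.2.1)) (fun c => (e c).1)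
    (fun c => P.bits₁₂ (e c).2) (fun y c z => g y (e c).2 * P.out₂ y (e c).2 z)
    (fun y => tsum_ite_fst_eq_le_one e (g y) (hg y) (P.out₂ y)) (fun ω hω => ?_) hρ
    (le_trans (by simp only [Equiv.apply_symm_apply]; exact tsum_jointLaw_mul_le P.bits₁₂) hrate)
  · refine hmain.trans_eq ?_
    conv_rhs => rw [← jointLaw_map_fst (P := P) (r := r) (q := q) (hq := hq) (h := h)]
    rw [condMutualInfo_map]
    simp
  · have h1 := probAt_jointLaw_eq (P := P) (r := r) (q := q) (hq := hq) (h := h) e ω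
    have h2 := probAt_jointLaw_input (P := P) (r := r) (q := q) (hq := hq) (h := h) e ω
    rw [PMF.probAt_congr (B := fun ω => (ω.1.1.2, ω.1.1.1, ω.2.2, e.symm (ω.1.2, ω.2.1)))
      fun ω' => by simp only [Prod.mk.injEq]; tauto] at h1
    rw [PMF.probAt_congr (B := fun ω => (ω.1.1.2, ω.1.1.1, (e (e.symm (ω.1.2, ω.2.1))).1))
      fun ω' => by simp only [Prod.mk.injEq]; tauto] at h2
    rw [h1, h2, jointLaw_apply, Equiv.apply_symm_apply]
    refine mul_le_mul_right ?_ _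
    have hu : q ω.1 ≠ 0 := fun h0 => hω (by rw [jointLaw_apply, h0, zero_mul])
    calc P.transcriptProb ω.1.1.1 ω.1.1.2 ω.2.1 *
          (P.out₁ ω.1.1.1 ω.2.1 ω.2.2 * P.out₂ ω.1.1.2 ω.2.1 ω.2.2)
        ≤ (g ω.1.1.2 ω.2.1 * 2 ^ P.bits₁₂ ω.2.1) * (1 * P.out₂ ω.1.1.2 ω.2.1 ω.2.2) :=
          mul_le_mul' (hgle _ _ _ (input_ne_zero_of_ne_zero hq hu))
            (mul_le_mul' (PMF.coe_le_one _ _) le_rfl)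
      _ = _ := by ring

end Protocol

/-- A protocol with rates `ρ` moves a point of the tension region by at most `(ρ₂, ρ₁)`. -/
theorem add_mem_tensionSlice_pairLaw {X Y Z : Type*} [Finite X] [Finite Y]
    {r : PMF ((X × Y) × Z)} {ρ : ℝ × ℝ} (hρ : ρ ∈ rateRegion (r.map fun ω => (ω.1, (ω.2, ω.2))))
    {s : ℝ × ℝ} (hs : s ∈ tensionSlice 0 (r.map Prod.fst)) :
    (s.1 + ρ.2, s.2 + ρ.1) ∈ tensionSlice 0 (pairLaw r) := by
  obtain ⟨hρ₁, hρ₂, P, hP, hprod, hr₁, hr₂⟩ := hρ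
  obtain ⟨hs₁, hs₂, q, hq, hq₁, hq₂, hq₃⟩ := hs
  have hfst : (r.map fun ω => (ω.1, (ω.2, ω.2))).map Prod.fst = r.map Prod.fst := by
    rw [PMF.map_comp]
    rfl
  rw [hfst] at hP hprod hr₁ hr₂
  -- Auxiliary variables are `ℕ`-valued, so the pair of `Q` and the transcript is coded by a
  -- bijection.
  obtain ⟨e⟩ : Nonempty (ℕ ≃ ℕ × Transcript) := nonempty_equiv_of_countable
  refine ⟨add_nonneg hs₁ hρ₂, add_nonneg hs₂ hρ₁, (P.jointLaw r q hq hprod).map fun ω =>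
    (((ω.1.1.1, ω.2.2), (ω.1.1.2, ω.2.2)), e.symm (ω.1.2, ω.2.1)), ?_, ?_, ?_, ?_⟩
  · rw [PMF.map_comp]
    conv_rhs => rw [pairLaw, ← Protocol.jointLaw_map_input_output (P := P) (r := r) (q := q)
      (hq := hq) (h := hprod), PMF.map_comp]
    rfl
  · rw [condMutualInfo_map]
    exact (Protocol.condMutualInfo_jointLaw_le₁ e hP hρ₂ hr₂).trans (add_le_add_left hq₁ _)
  · rw [condMutualInfo_map]
    exact (Protocol.condMutualInfo_jointLaw_le₂ e hP hρ₁ hr₁).trans (add_le_add_left hq₂ _)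
  · rw [condMutualInfo_map]
    exact (Protocol.condMutualInfo_jointLaw_eq_zero e hq₃).le

/-! ### Consequences for the Wyner-tension -/

theorem wynerTension_pairLaw_le {X Y Z : Type*} [Finite X] [Finite Y]
    {r : PMF ((X × Y) × Z)} {ρ : ℝ × ℝ}
    (hρ : ρ ∈ rateRegion (r.map fun ω => (ω.1, (ω.2, ω.2)))) :
    wynerTension (pairLaw r) - wynerTension (r.map Prod.fst) ≤ ((ρ.1 + ρ.2 : ℝ) : EReal) := by
  refine EReal.sub_le_of_le_add' ?_
  -- The rate sum is a real number, so it can change sides in `EReal`. This isolates the infimum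
  -- without knowing that either tension is finite.
  rw [← EReal.sub_le_iff_le_add (Or.inl (EReal.coe_ne_bot _)) (Or.inl (EReal.coe_ne_top _))]
  refine le_iInf₂ fun s hs => ?_
  refine EReal.sub_le_of_le_add ((iInf₂_le _ (add_mem_tensionSlice_pairLaw hρ hs)).trans_eq ?_)
  rw [← EReal.coe_add]
  congr 1
  ring

theorem wynerTension_nonneg {α β : Type*} (p : PMF (α × β)) : 0 ≤ wynerTension p :=
  le_iInf₂ fun _ hr => EReal.coe_nonneg.2 (add_nonneg hr.1 hr.2.1)

theorem wynerTension_eq_zero_of_indep {α β : Type*} {p : PMF (α × β)}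
    (hp : ∀ x y, p (x, y) = p.map Prod.fst x * p.map Prod.snd y) : wynerTension p = 0 := by
  classical
  refine le_antisymm ?_ (wynerTension_nonneg p)
  have hmem : ((0, 0) : ℝ × ℝ) ∈ tensionSlice 0 p := by
    -- The witness is a constant `Q`: it carries no information, and conditioning on it leaves the
    -- independence of the pair intact.
    refine ⟨le_rfl, le_rfl, p.map fun xy => (xy, 0), by rw [PMF.map_comp]; exact PMF.map_id _,
      ?_, ?_, ?_⟩
    · rw [condMutualInfo_map]
      refine (condMutualInfo_eq_zero_of_factor (fun y x => p (x, y))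
        (fun n _ => if n = 0 then 1 else 0) fun y n x => ?_).le
      by_cases hn : n = 0
      · subst hn
        simpa using PMF.map_apply_of_injective p (g := fun xy => (xy.2, (0 : ℕ), xy.1))
          (fun u v huv => by
            simp only [Prod.mk.injEq] at huv
            exact Prod.ext huv.2.2 huv.1) (x, y)
      · rw [PMF.map_apply_eq_zero _ fun ω hω => hn (by simp_all)]
        simp [hn]
    · rw [condMutualInfo_map]
      refine (condMutualInfo_eq_zero_of_factor (fun x y => p (x, y))
        (fun n _ => if n = 0 then 1 else 0) fun x n y => ?_).le
      by_cases hn : n = 0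
      · subst hn
        simpa using PMF.map_apply_of_injective p (g := fun xy => (xy.1, (0 : ℕ), xy.2))
          (fun u v huv => by
            simp only [Prod.mk.injEq] at huv
            exact Prod.ext huv.1 huv.2.2) (x, y)
      · rw [PMF.map_apply_eq_zero _ fun ω hω => hn (by simp_all)]
        simp [hn]
    · rw [condMutualInfo_map]
      refine (condMutualInfo_eq_zero_of_factor
        (fun x n => p.map Prod.fst x * if n = 0 then 1 else 0) (fun y _ => p.map Prod.snd y) fun x y n => ?_).le
      by_cases hn : n = 0
      · subst hn
        rw [if_pos rfl, mul_one, ← hp]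
        exact PMF.map_apply_of_injective p (g := fun xy => (xy.1, xy.2, (0 : ℕ)))
          (fun u v huv => by
            simp only [Prod.mk.injEq] at huv
            exact Prod.ext huv.1 huv.2.1) (x, y)
      · rw [PMF.map_apply_eq_zero _ fun ω hω => hn (by simp_all)]
        simp [hn]
  exact (iInf₂_le _ hmem).trans (by simp)

end

theorem mainTheorem6 {X Y : Type*} [Fintype X] [Fintype Y] (p : PMF (X × Y))
    (f : X × Y → Bool) (ε : ℝ) (hε : 0 ≤ ε) :
    (⨅ r ∈ approxLaws p f ε, (wynerTension (pairLaw r) - wynerTension p)) ≤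
        commComplexity p f ε ∧
      ((∀ x y, p (x, y) = p.map Prod.fst x * p.map Prod.snd y) →
        wynerTension p = 0 ∧
        (⨅ r ∈ approxLaws p f ε, wynerTension (pairLaw r)) ≤ commComplexity p f ε) := by
  have hmain : (⨅ r ∈ approxLaws p f ε, (wynerTension (pairLaw r) - wynerTension p)) ≤
      commComplexity p f ε := by
    refine le_iInf₂ fun ρ hρ => ?_
    obtain ⟨r, hr, hρ⟩ := Set.mem_iUnion₂.1 hρ
    refine (iInf₂_le r hr).trans ?_
    rw [← hr.1]
    exact wynerTension_pairLaw_le hρ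
  refine ⟨hmain, fun hp => ?_⟩
  have h0 := wynerTension_eq_zero_of_indep hp
  refine ⟨h0, ?_⟩
  simpa only [h0, sub_zero] using hmain
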